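/- Let $X=[0,\pi/2]$, let $\mathcal A=\mathbb{R}[x,\sin x]$ be the algebra of real-valued functions on $X$ generated over $\mathbb{R}$ by the functions $x\mapsto x$ and $x\mapsto\sin x$, and for $k\ge 0$ let $$p_k(x)=\sum_{j=0}^{k}(-1)^j\frac{x^{2j+1}}{(2j+1)!}.$$ Let $f\in\mathcal A$ satisfy $f(x)>0$ for all $x\in[0,\pi/2]$. Then there exist an integer $k\ge 0$ and polynomials $\sigma,\sigma_0,\sigma_2,\sigma_3,\sigma_4\in\mathbb{R}[y_1,y_2]$, each a (finite) sum of squares of polynomials in $\mathbb{R}[y_1,y_2]$, such that for all $x\in[0,\pi/2]$ $$f(x)=\sigma(x,\sin x)+x\,\sigma_0(x,\sin x)+\Big(\frac{\pi}{2}-x\Big)\sigma_2(x,\sin x)+\big[p_{2k}(x)-\sin x\big]\sigma_3(x,\sin x)+\big[\sin x-p_{2k+1}(x)\big]\sigma_4(x,\sin x).$$ -/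

import Mathlib

noncomputable section

/-- The interval `X = [0, π/2]`. -/
abbrev SinDomain : Set ℝ := Set.Icc (0 : ℝ) (Real.pi / 2)

/-- The algebra `ℝ[x, sin x]` of real-valued functions on `[0, π/2]`. -/
def polySinAlgebra : Subalgebra ℝ (SinDomain → ℝ) :=
  Algebra.adjoin ℝ {fun x : SinDomain => (x : ℝ), fun x : SinDomain => Real.sin (x : ℝ)}

/-- The Taylor polynomial `p_k(x) = ∑_{j=0}^k (-1)^j x^(2j+1) / (2j+1)!` of the sine. -/
def sinTaylor (k : ℕ) : Polynomial ℝ :=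
  ∑ j ∈ Finset.range (k + 1),
    Polynomial.C ((-1 : ℝ) ^ j / (Nat.factorial (2 * j + 1) : ℝ)) * Polynomial.X ^ (2 * j + 1)

/-- The value `σ(x, sin x)` of a polynomial `σ ∈ ℝ[y₁, y₂]`. -/
def evalSin (σ : MvPolynomial (Fin 2) ℝ) (x : ℝ) : ℝ :=
  MvPolynomial.eval ![x, Real.sin x] σ

end

open Filter Topology Set

/-! Write f as F(x, sin x) for a polynomial F. By compactness F is positive near the graph of the
sine. Taylor polynomials converge uniformly, so F is positive on the strip cut out by the four
generators for large k; the alternating bounds on the sine are never needed.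

The quadratic module M of the strip is archimedean, so a Putinar-type theorem
(`mem_of_forall_algHom_pos`) puts F in M, and substituting y₂ = sin x gives the formula.

That theorem is proved with states: if F ∉ M, some state is nonpositive at F. States form a compact
convex set, so the minimum at F is attained at an extreme state. Extreme states are multiplicative,
here evaluations at points of the strip, where F > 0. -/

/-- A log-convex sequence of nonnegative reals with growth `C * N ^ n` has first ratio at most
`N`. -/
theorem le_mul_of_sq_le_mul_of_le_mul_pow {u : ℕ → ℝ} {C N : ℝ} (hN : 0 < N)
    (h0 : ∀ n, 0 ≤ u n) (hu : ∀ n, u (n + 1) ^ 2 ≤ u n * u (n + 2))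
    (hb : ∀ n, u n ≤ C * N ^ n) : u 1 ≤ N * u 0 := by
  by_contra! hlt
  rcases (h0 0).eq_or_lt with h | hpos
  · have h1 := hu 0
    rw [← h] at h1 hlt
    nlinarith
  set r := u 1 / u 0 with hr
  have hNr : N < r := by rwa [hr, lt_div_iff₀ hpos]
  have hr0 : 0 < r := hN.trans hNr
  have step : ∀ n, 0 < u n ∧ r * u n ≤ u (n + 1) := by
    intro n
    induction n with
    | zero => exact ⟨hpos, by rw [hr]; field_simp; simp⟩
    | succ n ih =>
      obtain ⟨h1, h2⟩ := ih
      have h3 : 0 < u (n + 1) := lt_of_lt_of_le (mul_pos hr0 h1) h2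
      refine ⟨h3, le_of_mul_le_mul_left ?_ h1⟩
      calc u n * (r * u (n + 1)) = (r * u n) * u (n + 1) := by ring
        _ ≤ u (n + 1) * u (n + 1) := by gcongr
        _ ≤ _ := by have := hu n; rwa [sq] at this
  have grow : ∀ n, u 0 * r ^ n ≤ u n := by
    intro n
    induction n with
    | zero => simp
    | succ n ih =>
      calc u 0 * r ^ (n + 1) = r * (u 0 * r ^ n) := by ring
        _ ≤ r * u n := by gcongr
        _ ≤ _ := (step n).2
  obtain ⟨n, hn⟩ := pow_unbounded_of_one_lt (C / u 0) ((one_lt_div hN).2 hNr)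
  rw [div_pow, div_lt_div_iff₀ hpos (pow_pos hN n)] at hn
  linarith [grow n, hb n]

/-! ### States of archimedean quadratic modules and the representation theorem. -/

section QuadraticModule

variable {A : Type*} [CommRing A] [Algebra ℝ A]

/-- A convex cone in a commutative `ℝ`-algebra is an archimedean quadratic module if it contains
`1`, is stable under multiplication by squares, and `1` is an order unit for it. -/
structure IsArchimedeanQuadraticModule (M : PointedCone ℝ A) : Prop where
  one_mem : (1 : A) ∈ M
  mul_self_mul_mem : ∀ (a : A) {m : A}, m ∈ M → a * a * m ∈ M
  exists_sub_mem : ∀ a : A, ∃ c : ℝ, algebraMap ℝ A c - a ∈ M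

/-- The normalized positive functionals of a convex cone. -/
def coneStates (M : PointedCone ℝ A) : Set (A → ℝ) :=
  {φ | (∀ a b, φ (a + b) = φ a + φ b) ∧ (∀ (c : ℝ) a, φ (c • a) = c * φ a) ∧ φ 1 = 1 ∧
    ∀ m ∈ M, 0 ≤ φ m}

namespace coneStates

variable {M : PointedCone ℝ A} {φ : A → ℝ}

theorem map_sub (hφ : φ ∈ coneStates M) (a b : A) : φ (a - b) = φ a - φ b := by
  have h := hφ.1 (a - b) b
  rw [sub_add_cancel] at h
  linarith

theorem map_zero (hφ : φ ∈ coneStates M) : φ 0 = 0 := by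
  simpa using hφ.2.1 0 0

theorem map_algebraMap (hφ : φ ∈ coneStates M) (c : ℝ) : φ (algebraMap ℝ A c) = c := by
  rw [Algebra.algebraMap_eq_smul_one, hφ.2.1, hφ.2.2.1, mul_one]

theorem le_of_sub_mem (hφ : φ ∈ coneStates M) {c : ℝ} {a : A}
    (h : algebraMap ℝ A c - a ∈ M) : φ a ≤ c := by
  have := hφ.2.2.2 _ h
  rw [map_sub hφ, map_algebraMap hφ] at this
  linarith

/-- Tychonoff: the order unit confines each φ a to a compact interval, and the defining conditions
are closed pointwise. -/
theorem isCompact (hM : IsArchimedeanQuadraticModule M) : IsCompact (coneStates M) := by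
  choose c hc using hM.exists_sub_mem
  refine (isCompact_univ_pi fun a => isCompact_Icc (a := -c (-a)) (b := c a)).of_isClosed_subset
    ?_ ?_
  · have h1 : IsClosed {φ : A → ℝ | ∀ a b, φ (a + b) = φ a + φ b} := by
      simp only [ofPred_forall]
      exact isClosed_iInter fun a => isClosed_iInter fun b => isClosed_eq (by fun_prop) (by fun_prop)
    have h2 : IsClosed {φ : A → ℝ | ∀ (c : ℝ) a, φ (c • a) = c * φ a} := by
      simp only [ofPred_forall]
      exact isClosed_iInter fun a => isClosed_iInter fun b => isClosed_eq (by fun_prop) (by fun_prop)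
    have h3 : IsClosed {φ : A → ℝ | φ 1 = 1} := isClosed_eq (by fun_prop) (by fun_prop)
    have h4 : IsClosed {φ : A → ℝ | ∀ m ∈ M, 0 ≤ φ m} := by
      simp only [ofPred_forall]
      exact isClosed_iInter fun a => isClosed_iInter fun b => isClosed_le (by fun_prop) (by fun_prop)
    exact h1.inter (h2.inter (h3.inter h4))
  · intro φ hφ a _
    refine ⟨?_, le_of_sub_mem hφ (hc a)⟩
    have h1 := le_of_sub_mem hφ (hc (-a))
    have h2 := map_sub hφ 0 a
    rw [zero_sub, map_zero hφ] at h2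
    linarith

/-- A positive functional bounds multiplication by a bounded square. -/
theorem map_mul_self_mul_le (hM : IsArchimedeanQuadraticModule M) (hφ : φ ∈ coneStates M)
    {a : A} {N : ℝ} (hN : 0 < N) (ha : algebraMap ℝ A N - a * a ∈ M) {m : A} (hm : m ∈ M) :
    φ (a * a * m) ≤ N * φ m := by
  obtain ⟨C, hC⟩ := hM.exists_sub_mem m
  have hC' : algebraMap ℝ A (max C 0) - m ∈ M := by
    have h := M.add_mem hC (M.smul_mem (sub_nonneg.2 (le_max_left C 0)) hM.one_mem)
    rw [← Algebra.algebraMap_eq_smul_one, RingHom.map_sub] at h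
    convert h using 1
    ring
  have hpow : ∀ n : ℕ, φ (a ^ n * a ^ n) ≤ N ^ n := by
    intro n
    induction n with
    | zero => simp [hφ.2.2.1]
    | succ n ih =>
      have h := hφ.2.2.2 _ (hM.mul_self_mul_mem (a ^ n) ha)
      have e : a ^ n * a ^ n * (algebraMap ℝ A N - a * a)
          = N • (a ^ n * a ^ n) - a ^ (n + 1) * a ^ (n + 1) := by
        rw [Algebra.smul_def]; ring
      rw [e, map_sub hφ, hφ.2.1] at h
      calc φ (a ^ (n + 1) * a ^ (n + 1)) ≤ N * φ (a ^ n * a ^ n) := by linarith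
        _ ≤ N * N ^ n := by gcongr
        _ = N ^ (n + 1) := by ring
  -- The moments φ(a²ⁿm) are log-convex by Cauchy–Schwarz and at most C Nⁿ. This replaces
  -- multiplying m by N - a², which may leave M.
  have key := le_mul_of_sq_le_mul_of_le_mul_pow (u := fun n => φ (a ^ n * a ^ n * m))
    (C := max C 0) hN (fun n => hφ.2.2.2 _ (hM.mul_self_mul_mem _ hm)) ?_ ?_
  · simpa using key
  · intro n
    have h := discrim_le_zero (a := φ (a ^ n * a ^ n * m))
      (b := -2 * φ (a ^ (n + 1) * a ^ (n + 1) * m))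
      (c := φ (a ^ (n + 2) * a ^ (n + 2) * m)) ?_
    · rw [discrim] at h
      linarith
    · intro x
      have h := hφ.2.2.2 _ (hM.mul_self_mul_mem (x • a ^ n - a ^ (n + 2)) hm)
      have e : (x • a ^ n - a ^ (n + 2)) * (x • a ^ n - a ^ (n + 2)) * m
          = (x * x) • (a ^ n * a ^ n * m) + (-2 * x) • (a ^ (n + 1) * a ^ (n + 1) * m)
            + a ^ (n + 2) * a ^ (n + 2) * m := by
        simp only [Algebra.smul_def, map_mul, map_neg, map_ofNat]
        ring
      rw [e, hφ.1, hφ.1, hφ.2.1, hφ.2.1] at h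
      linarith
  · intro n
    have h := hφ.2.2.2 _ (hM.mul_self_mul_mem (a ^ n) hC')
    have e : a ^ n * a ^ n * (algebraMap ℝ A (max C 0) - m)
        = max C 0 • (a ^ n * a ^ n) - a ^ n * a ^ n * m := by
      rw [Algebra.smul_def]; ring
    rw [e, map_sub hφ, hφ.2.1] at h
    calc φ (a ^ n * a ^ n * m) ≤ max C 0 * φ (a ^ n * a ^ n) := by linarith
      _ ≤ max C 0 * N ^ n := by gcongr; exact hpow n

/-- With t = φ(a²) in (0, N), φ is a convex combination of the states φ(a²·)/t and φ((N - a²)·)/(N -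
t); extremality makes the first equal to φ. -/
theorem map_mul_self_mul_of_mem_extremePoints (hM : IsArchimedeanQuadraticModule M)
    (hφ : φ ∈ (coneStates M).extremePoints ℝ) (a b : A) :
    φ (a * a * b) = φ (a * a) * φ b := by
  have hφ' := hφ.1
  obtain ⟨c, hc⟩ := hM.exists_sub_mem (a * a)
  -- The extra 1 makes φ(a²) < N strict, so that N - t can be inverted.
  set N := max c 0 + 1 with hNdef
  have hcN : c ≤ N := (le_max_left c 0).trans (by linarith)
  have hN : 0 < N := by positivity
  have ha : algebraMap ℝ A N - a * a ∈ M := by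
    have h := M.add_mem hc (M.smul_mem (sub_nonneg.2 hcN) hM.one_mem)
    rw [← Algebra.algebraMap_eq_smul_one, RingHom.map_sub] at h
    convert h using 1
    ring
  have hlt : φ (a * a) < N := by
    have := le_of_sub_mem hφ' hc
    linarith [le_max_left c 0]
  have haa : a * a ∈ M := by simpa using hM.mul_self_mul_mem a hM.one_mem
  rcases (hφ'.2.2.2 _ haa).eq_or_lt with h0 | hpos
  · have hz : ∀ b, φ (a * a * b) ≤ 0 := by
      intro b
      obtain ⟨d, hd⟩ := hM.exists_sub_mem b
      have h := hφ'.2.2.2 _ (hM.mul_self_mul_mem a hd)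
      have e : a * a * (algebraMap ℝ A d - b) = d • (a * a) - a * a * b := by
        rw [Algebra.smul_def]; ring
      rw [e, map_sub hφ', hφ'.2.1, ← h0] at h
      linarith
    have h1 := hz (-b)
    rw [mul_neg, ← zero_sub, map_sub hφ', map_zero hφ'] at h1
    rw [← h0, zero_mul]
    linarith [hz b]
  · set t := φ (a * a) with ht
    have hNt : 0 < N - t := by linarith
    have hψ : (fun b => t⁻¹ * φ (a * a * b)) ∈ coneStates M := by
      refine ⟨fun x y => ?_, fun r x => ?_, ?_, fun m hm => ?_⟩
      · simp only [mul_add, hφ'.1]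
      · simp only [mul_smul_comm, hφ'.2.1]; ring
      · simp only [mul_one]; exact inv_mul_cancel₀ hpos.ne'
      · exact mul_nonneg (inv_nonneg.2 hpos.le) (hφ'.2.2.2 _ (hM.mul_self_mul_mem a hm))
    have hχ : (fun b => (N - t)⁻¹ * (N * φ b - φ (a * a * b))) ∈ coneStates M := by
      refine ⟨fun x y => ?_, fun r x => ?_, ?_, fun m hm => ?_⟩
      · simp only [mul_add, hφ'.1]; ring
      · simp only [mul_smul_comm, hφ'.2.1]; ring
      · simp only [mul_one, hφ'.2.2.1]; exact inv_mul_cancel₀ hNt.ne'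
      · exact mul_nonneg (inv_nonneg.2 hNt.le)
          (sub_nonneg.2 (map_mul_self_mul_le hM hφ' hN ha hm))
    have hseg := hφ.2 hψ hχ ⟨t / N, (N - t) / N, by positivity, by positivity,
      by field_simp; ring, by
        ext x
        simp only [Pi.add_apply, Pi.smul_apply, smul_eq_mul]
        field_simp
        ring⟩
    have := congrFun hseg b
    rw [← this]
    field_simp

theorem map_mul_of_mem_extremePoints (hM : IsArchimedeanQuadraticModule M)
    (hφ : φ ∈ (coneStates M).extremePoints ℝ) (a b : A) : φ (a * b) = φ a * φ b := by
  have hφ' := hφ.1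
  -- Polarization reduces products to squares.
  have e : ∀ b : A, (4 : ℝ) • (a * b) = (a + 1) * (a + 1) * b - (a - 1) * (a - 1) * b := by
    intro b
    rw [Algebra.smul_def, map_ofNat]; ring
  have h1 := congrArg φ (e b)
  have h2 := congrArg φ (e 1)
  rw [map_sub hφ', hφ'.2.1, map_mul_self_mul_of_mem_extremePoints hM hφ,
    map_mul_self_mul_of_mem_extremePoints hM hφ] at h1
  rw [mul_one, mul_one, mul_one, map_sub hφ', hφ'.2.1] at h2
  linear_combination h1 / 4 - h2 * φ b / 4

/-- An extreme normalized positive functional of an archimedean quadratic module is a character. -/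
theorem exists_algHom_eq (hM : IsArchimedeanQuadraticModule M)
    (hφ : φ ∈ (coneStates M).extremePoints ℝ) : ∃ χ : A →ₐ[ℝ] ℝ, ∀ a, χ a = φ a :=
  ⟨{ toFun := φ
     map_one' := hφ.1.2.2.1
     map_mul' := map_mul_of_mem_extremePoints hM hφ
     map_zero' := map_zero hφ.1
     map_add' := hφ.1.1
     commutes' := map_algebraMap hφ.1 }, fun _ => rfl⟩

/-- An element outside an archimedean quadratic module is nonpositive at some state. -/
theorem exists_nonpos_of_notMem (hM : IsArchimedeanQuadraticModule M) {F : A} (hF : F ∉ M) :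
    ∃ φ ∈ coneStates M, φ F ≤ 0 := by
  have hneg : (-1 : A) ∉ M := by
    intro h
    obtain ⟨c, hc⟩ := hM.exists_sub_mem (-F)
    refine hF ?_
    have h1 := M.add_mem hc (M.add_mem (M.smul_mem (abs_nonneg c) h)
      (M.smul_mem (sub_nonneg.2 (le_abs_self c)) hM.one_mem))
    convert h1 using 1
    simp only [Algebra.smul_def, RingHom.map_sub]
    ring
  -- The cone M - ℝ≥0 F: a functional nonnegative on it is nonnegative on M and nonpositive at F.
  let s : PointedCone ℝ A :=
    { carrier := {x | ∃ m ∈ M, ∃ r : ℝ, 0 ≤ r ∧ x = m - r • F}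
      zero_mem' := ⟨0, M.zero_mem, 0, le_rfl, by simp⟩
      add_mem' := by
        rintro _ _ ⟨m, hm, r, hr, rfl⟩ ⟨m', hm', r', hr', rfl⟩
        exact ⟨m + m', M.add_mem hm hm', r + r', add_nonneg hr hr', by rw [add_smul]; abel⟩
      smul_mem' := by
        rintro ⟨c, hc⟩ _ ⟨m, hm, r, hr, rfl⟩
        refine ⟨c • m, M.smul_mem hc hm, c * r, mul_nonneg hc hr, ?_⟩
        rw [mul_smul, ← smul_sub]
        rfl }
  have hs : (-1 : A) ∉ s := by
    rintro ⟨m, hm, r, hr, h⟩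
    rcases hr.eq_or_lt with rfl | hr
    · rw [zero_smul, sub_zero] at h
      exact hneg (h ▸ hm)
    · refine hF ?_
      have h1 := M.smul_mem (inv_nonneg.2 hr.le) (M.add_mem hm hM.one_mem)
      convert h1 using 1
      have : m + 1 = r • F := by linear_combination -h
      rw [this, smul_smul, inv_mul_cancel₀ hr.ne', one_smul]
  have h1ne : (1 : A) ≠ 0 := by
    intro h
    rw [h, neg_zero] at hneg
    exact hneg M.zero_mem
  obtain ⟨g, hg1, hg2⟩ := riesz_extension s (LinearPMap.mkSpanSingleton (1 : A) (1 : ℝ) h1ne)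
    (by
      rintro ⟨x, hx⟩ hxs
      obtain ⟨c, rfl⟩ := Submodule.mem_span_singleton.1 hx
      rw [LinearPMap.mkSpanSingleton'_apply]
      by_contra! hc
      have hc' : c < 0 := by simpa using hc
      apply hs
      have := s.smul_mem (inv_nonneg.2 (neg_nonneg.2 hc'.le)) hxs
      simp only [smul_smul] at this
      convert this using 1
      rw [inv_neg, neg_mul, inv_mul_cancel₀ hc'.ne, neg_smul, one_smul])
    (by
      intro y
      obtain ⟨c, hc⟩ := hM.exists_sub_mem (-y)
      refine ⟨⟨algebraMap ℝ A c, ?_⟩, _, hc, 0, le_rfl, by simp⟩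
      rw [Algebra.algebraMap_eq_smul_one]
      exact Submodule.smul_mem _ _ (Submodule.mem_span_singleton_self _))
  refine ⟨g, ⟨g.map_add, fun c a => by simp, ?_, fun m hm => ?_⟩, ?_⟩
  · have := hg1 ⟨1, Submodule.mem_span_singleton_self _⟩
    rwa [LinearPMap.mkSpanSingleton_apply] at this
  · exact hg2 _ ⟨m, hm, 0, le_rfl, by simp⟩
  · have := hg2 (-F) ⟨0, M.zero_mem, 1, zero_le_one, by simp⟩
    simpa using this

end coneStates

/-- **Representation theorem** for archimedean quadratic modules: an element that is positive under
every character nonnegative on the module belongs to the module. -/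
theorem IsArchimedeanQuadraticModule.mem_of_forall_algHom_pos {M : PointedCone ℝ A}
    (hM : IsArchimedeanQuadraticModule M) {F : A}
    (hF : ∀ χ : A →ₐ[ℝ] ℝ, (∀ m ∈ M, 0 ≤ χ m) → 0 < χ F) : F ∈ M := by
  by_contra hFM
  obtain ⟨φ, hφ, hφF⟩ := coneStates.exists_nonpos_of_notMem hM hFM
  set l : StrongDual ℝ (A → ℝ) := -ContinuousLinearMap.proj (R := ℝ) (φ := fun _ : A => ℝ) F
  have hl : ∀ ψ, l ψ = -ψ F := fun ψ => rfl
  -- The face of states minimizing the value at F; its extreme points are extreme among all states.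
  have hexp : IsExposed ℝ (coneStates M) (l.toExposed (coneStates M)) :=
    ContinuousLinearMap.toExposed.isExposed
  have hK := coneStates.isCompact hM
  obtain ⟨φ₀, hφ₀, hmax⟩ := hK.exists_isMaxOn ⟨φ, hφ⟩ l.continuous.continuousOn
  obtain ⟨ψ, hψ⟩ := (hexp.isCompact hK).extremePoints_nonempty ⟨φ₀, hφ₀, fun y hy => hmax hy⟩
  have hle := hψ.1.2 φ hφ
  rw [hl, hl] at hle
  obtain ⟨χ, hχ⟩ := coneStates.exists_algHom_eq hM
    (hexp.isExtreme.extremePoints_subset_extremePoints hψ)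
  have := hF χ fun m hm => by rw [hχ]; exact hψ.1.1.2.2.2 m hm
  rw [hχ] at this
  linarith

end QuadraticModule

/-! ### Bounded elements and finitely generated quadratic modules. -/

section Generators

variable {A : Type*} [CommRing A] [Algebra ℝ A]

theorem algebraMap_mem_of_nonneg {M : PointedCone ℝ A} (h1 : (1 : A) ∈ M) {c : ℝ} (hc : 0 ≤ c) :
    algebraMap ℝ A c ∈ M := by
  rw [Algebra.algebraMap_eq_smul_one]
  exact M.smul_mem hc h1

/-- The elements bounded on both sides by real constants, relative to a quadratic module. -/
def boundedSubalgebra (M : PointedCone ℝ A) (h1 : (1 : A) ∈ M)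
    (hsq : ∀ (a : A) {m : A}, m ∈ M → a * a * m ∈ M) : Subalgebra ℝ A where
  carrier := {a | ∃ c : ℝ, algebraMap ℝ A c - a ∈ M ∧ algebraMap ℝ A c + a ∈ M}
  algebraMap_mem' r := by
    refine ⟨|r|, ?_, ?_⟩
    · rw [← RingHom.map_sub]
      exact algebraMap_mem_of_nonneg h1 (sub_nonneg.2 (le_abs_self r))
    · rw [← RingHom.map_add]
      exact algebraMap_mem_of_nonneg h1 (by linarith [neg_abs_le r])
  add_mem' := by
    rintro a b ⟨c, hc1, hc2⟩ ⟨d, hd1, hd2⟩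
    refine ⟨c + d, ?_, ?_⟩ <;> rw [RingHom.map_add]
    · convert M.add_mem hc1 hd1 using 1; ring
    · convert M.add_mem hc2 hd2 using 1; ring
  mul_mem' := by
    have key : ∀ a : A, (∃ c : ℝ, algebraMap ℝ A c - a ∈ M ∧ algebraMap ℝ A c + a ∈ M) →
        ∃ c : ℝ, algebraMap ℝ A c - a * a ∈ M := by
      rintro a ⟨c, hc1, hc2⟩
      set N := |c| + 1
      have hN : 0 < N := by positivity
      have hcN : algebraMap ℝ A (N - c) ∈ M :=
        algebraMap_mem_of_nonneg h1 (by linarith [le_abs_self c])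
      rw [RingHom.map_sub] at hcN
      have h3 : algebraMap ℝ A N - a ∈ M := by convert M.add_mem hcN hc1 using 1; ring
      have h4 : algebraMap ℝ A N + a ∈ M := by convert M.add_mem hcN hc2 using 1; ring
      -- (N - a)²(N + a) + (N + a)²(N - a) = 2N(N² - a²) avoids products of two elements of M.
      have h5 := M.smul_mem (show 0 ≤ (2 * N)⁻¹ by positivity)
        (M.add_mem (hsq (algebraMap ℝ A N - a) h4) (hsq (algebraMap ℝ A N + a) h3))
      refine ⟨N ^ 2, ?_⟩
      convert h5 using 1
      have : (algebraMap ℝ A N - a) * (algebraMap ℝ A N - a) * (algebraMap ℝ A N + a) +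
          (algebraMap ℝ A N + a) * (algebraMap ℝ A N + a) * (algebraMap ℝ A N - a)
          = (2 * N) • (algebraMap ℝ A (N ^ 2) - a * a) := by
        simp only [Algebra.smul_def, map_mul, map_pow, map_ofNat]
        ring
      rw [this, smul_smul, inv_mul_cancel₀ (by positivity), one_smul]
    rintro a b ⟨c, hc1, hc2⟩ ⟨d, hd1, hd2⟩
    -- Bounds on ab come from 4ab = (a + b)² - (a - b)².
    obtain ⟨r, hr⟩ := key (a + b) ⟨c + d,
      by rw [RingHom.map_add]; convert M.add_mem hc1 hd1 using 1; ring,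
      by rw [RingHom.map_add]; convert M.add_mem hc2 hd2 using 1; ring⟩
    obtain ⟨s, hs⟩ := key (a - b) ⟨c + d,
      by rw [RingHom.map_add]; convert M.add_mem hc1 hd2 using 1; ring,
      by rw [RingHom.map_add]; convert M.add_mem hc2 hd1 using 1; ring⟩
    have hsqm : ∀ x : A, x * x ∈ M := fun x => by simpa using hsq x h1
    have h4 : ∀ x : A, (1 / 4 : ℝ) • ((4 : A) * x) = x := fun x => by
      rw [Algebra.smul_def, ← mul_assoc, ← map_ofNat (algebraMap ℝ A) 4, ← RingHom.map_mul]
      norm_num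
    have h16 : (0 : ℝ) ≤ 1 / 4 := by norm_num
    have hr0 := algebraMap_mem_of_nonneg h1 (show 0 ≤ |r| - r by linarith [le_abs_self r])
    have hs0 := algebraMap_mem_of_nonneg h1 (show 0 ≤ |s| - s by linarith [le_abs_self s])
    have hr1 := algebraMap_mem_of_nonneg h1 (abs_nonneg r)
    have hs1 := algebraMap_mem_of_nonneg h1 (abs_nonneg s)
    rw [RingHom.map_sub] at hr0 hs0
    have e : algebraMap ℝ A ((|r| + |s|) / 4)
        = (1 / 4 : ℝ) • (algebraMap ℝ A |r| + algebraMap ℝ A |s|) := by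
      rw [Algebra.smul_def, ← RingHom.map_add, ← RingHom.map_mul]
      congr 1; ring
    refine ⟨(|r| + |s|) / 4, ?_, ?_⟩
    · rw [e, ← h4 (a * b), ← smul_sub]
      refine M.smul_mem h16 ?_
      convert M.add_mem (M.add_mem hr hr0) (M.add_mem hs1 (hsqm (a - b))) using 1
      ring
    · rw [e, ← h4 (a * b), ← smul_add]
      refine M.smul_mem h16 ?_
      convert M.add_mem (M.add_mem hs hs0) (M.add_mem hr1 (hsqm (a + b))) using 1
      ring

theorem IsSumSq.real_smul {a : A} (ha : IsSumSq a) {c : ℝ} (hc : 0 ≤ c) : IsSumSq (c • a) := by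
  rw [Algebra.smul_def, ← Real.mul_self_sqrt hc, RingHom.map_mul]
  exact (IsSumSq.mul_self _).mul ha

variable {ι : Type*} [Fintype ι]

/-- The quadratic module generated by a finite family. -/
def quadraticModule (g : ι → A) : PointedCone ℝ A where
  carrier := {p | ∃ (σ : A) (τ : ι → A), IsSumSq σ ∧ (∀ i, IsSumSq (τ i)) ∧
    p = σ + ∑ i, g i * τ i}
  zero_mem' := ⟨0, 0, .zero, fun _ => .zero, by simp⟩
  add_mem' := by
    rintro _ _ ⟨σ, τ, hσ, hτ, rfl⟩ ⟨σ', τ', hσ', hτ', rfl⟩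
    refine ⟨σ + σ', τ + τ', hσ.add hσ', fun i => (hτ i).add (hτ' i), ?_⟩
    simp only [Pi.add_apply, mul_add, Finset.sum_add_distrib]
    ring
  smul_mem' := by
    rintro ⟨c, hc⟩ _ ⟨σ, τ, hσ, hτ, rfl⟩
    refine ⟨c • σ, c • τ, hσ.real_smul hc, fun i => (hτ i).real_smul hc, ?_⟩
    change c • (σ + ∑ i, g i * τ i) = _
    simp only [Pi.smul_apply, mul_smul_comm, smul_add, Finset.smul_sum]

theorem one_mem_quadraticModule (g : ι → A) : 1 ∈ quadraticModule g :=
  ⟨1, 0, .one, fun _ => .zero, by simp⟩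

theorem mem_quadraticModule (g : ι → A) (i : ι) : g i ∈ quadraticModule g := by
  classical
  refine ⟨0, Pi.single i 1, .zero, fun j => ?_, ?_⟩
  · rcases eq_or_ne j i with rfl | h
    · rw [Pi.single_eq_same]; exact .one
    · rw [Pi.single_eq_of_ne h]; exact .zero
  · rw [Finset.sum_eq_single i] <;> simp +contextual [Pi.single_eq_of_ne]

theorem mul_self_mul_mem_quadraticModule (g : ι → A) (a : A) {m : A}
    (hm : m ∈ quadraticModule g) : a * a * m ∈ quadraticModule g := by
  obtain ⟨σ, τ, hσ, hτ, rfl⟩ := hm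
  refine ⟨a * a * σ, fun i => a * a * τ i, (IsSumSq.mul_self a).mul hσ,
    fun i => (IsSumSq.mul_self a).mul (hτ i), ?_⟩
  rw [mul_add, Finset.mul_sum]
  congr 1
  exact Finset.sum_congr rfl fun i _ => by ring

end Generators

/-! ### The strip around the graph of the sine. -/

open MvPolynomial in
/-- The generators describing the region `0 ≤ y₁ ≤ c`, `q(y₁) ≤ y₂ ≤ p(y₁)`. -/
noncomputable def stripGenerators (c : ℝ) (p q : Polynomial ℝ) :
    Fin 4 → MvPolynomial (Fin 2) ℝ :=
  ![X 0, C c - X 0, Polynomial.aeval (X 0) p - X 1, X 1 - Polynomial.aeval (X 0) q]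

-- The generators bound y₁, hence all polynomials in y₁, and squeeze y₂ between two of these;
-- bounded elements form a subalgebra.
open MvPolynomial in
theorem isArchimedeanQuadraticModule_strip (c : ℝ) (p q : Polynomial ℝ) :
    IsArchimedeanQuadraticModule (quadraticModule (stripGenerators c p q)) := by
  set M := quadraticModule (stripGenerators c p q) with hM
  have h1 : 1 ∈ M := one_mem_quadraticModule _
  have hsq : ∀ (a : MvPolynomial (Fin 2) ℝ) {m}, m ∈ M → a * a * m ∈ M :=
    fun a _ hm => mul_self_mul_mem_quadraticModule _ a hm
  set B := boundedSubalgebra M h1 hsq with hB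
  have g0 : X 0 ∈ M := mem_quadraticModule (stripGenerators c p q) 0
  have g1 : C c - X 0 ∈ M := mem_quadraticModule (stripGenerators c p q) 1
  have g2 : Polynomial.aeval (X 0) p - X 1 ∈ M := mem_quadraticModule (stripGenerators c p q) 2
  have g3 : X 1 - Polynomial.aeval (X 0) q ∈ M := mem_quadraticModule (stripGenerators c p q) 3
  have nonneg : ∀ r : ℝ, 0 ≤ r → C r ∈ M := fun r hr => algebraMap_mem_of_nonneg h1 hr
  have hX0 : X 0 ∈ B := by
    refine ⟨|c|, ?_, ?_⟩ <;> rw [algebraMap_eq]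
    · have := M.add_mem g1 (nonneg (|c| - c) (sub_nonneg.2 (le_abs_self c)))
      rw [C_sub] at this
      convert this using 1
      ring
    · exact M.add_mem (nonneg _ (abs_nonneg c)) g0
  have hpoly : ∀ r : Polynomial ℝ, Polynomial.aeval (X 0) r ∈ B := fun r =>
    Algebra.adjoin_le (Set.singleton_subset_iff.2 hX0) (Polynomial.aeval_mem_adjoin_singleton ℝ _)
  have hX1 : X 1 ∈ B := by
    obtain ⟨a, ha, -⟩ := hpoly p
    obtain ⟨b, -, hb⟩ := hpoly q
    rw [algebraMap_eq] at ha hb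
    have ha' := nonneg _ (sub_nonneg.2 (le_max_left a b))
    have hb' := nonneg _ (sub_nonneg.2 (le_max_right a b))
    rw [C_sub] at ha' hb'
    refine ⟨max a b, ?_, ?_⟩ <;> rw [algebraMap_eq]
    · convert M.add_mem (M.add_mem g2 ha) ha' using 1; ring
    · convert M.add_mem (M.add_mem g3 hb) hb' using 1; ring
  have hall : ∀ a, a ∈ B := by
    have : B = ⊤ := by
      rw [eq_top_iff, ← adjoin_range_X, Algebra.adjoin_le_iff]
      rintro _ ⟨i, rfl⟩
      fin_cases i
      exacts [hX0, hX1]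
    simp [this]
  exact ⟨h1, hsq, fun a => (hall a).imp fun _ h => h.1⟩

theorem tendstoUniformlyOn_sinTaylor :
    TendstoUniformlyOn (fun k x => (sinTaylor k).eval x) Real.sin atTop
      (Icc 0 (Real.pi / 2)) := by
  have hsum : Summable fun n : ℕ => (Real.pi / 2) ^ (2 * n + 1) / (2 * n + 1).factorial :=
    (Real.summable_pow_div_factorial (Real.pi / 2)).comp_injective
      (i := fun n : ℕ => 2 * n + 1) fun a b h => by simpa using h
  have h := tendstoUniformlyOn_tsum_nat hsum
    (f := fun n x => (-1) ^ n * x ^ (2 * n + 1) / ((2 * n + 1).factorial : ℝ))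
    (s := Icc 0 (Real.pi / 2)) ?_
  · have h' : TendstoUniformlyOn (fun N x => ∑ n ∈ Finset.range N,
        (-1) ^ n * x ^ (2 * n + 1) / ((2 * n + 1).factorial : ℝ)) Real.sin atTop
        (Icc 0 (Real.pi / 2)) :=
      h.congr_right fun x _ => (Real.hasSum_sin x).tsum_eq
    intro u hu
    -- `sinTaylor k` has k + 1 terms, hence the shift.
    filter_upwards [(tendsto_add_atTop_nat 1).eventually (h' u hu)] with k hk x hx
    convert hk x hx using 2
    simp only [sinTaylor, Polynomial.eval_finsetSum, Polynomial.eval_mul, Polynomial.eval_C,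
      Polynomial.eval_pow, Polynomial.eval_X]
    exact Finset.sum_congr rfl fun j _ => by ring
  · intro n x hx
    rw [norm_div, norm_mul, norm_pow, norm_neg, norm_one, one_pow, one_mul, norm_pow,
      Real.norm_of_nonneg hx.1, Real.norm_natCast]
    gcongr
    exacts [hx.1, hx.2]

/-- A polynomial positive on the graph of the sine is positive on a thin enough strip between
Taylor polynomials. -/
theorem exists_forall_strip_eval_pos (F : MvPolynomial (Fin 2) ℝ)
    (hF : ∀ x ∈ Icc 0 (Real.pi / 2), 0 < evalSin F x) :
    ∃ k : ℕ, ∀ x ∈ Icc 0 (Real.pi / 2), ∀ y : ℝ, y ≤ (sinTaylor (2 * k)).eval x →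
      (sinTaylor (2 * k + 1)).eval x ≤ y → 0 < MvPolynomial.eval ![x, y] F := by
  have htube : ∀ᶠ t : ℝ in 𝓝 0, ∀ x ∈ Icc 0 (Real.pi / 2),
      0 < MvPolynomial.eval ![x, Real.sin x + t] F := by
    refine isCompact_Icc.eventually_forall_of_forall_eventually fun x hx => ?_
    have hc : Continuous fun z : ℝ × ℝ => MvPolynomial.eval ![z.2, Real.sin z.2 + z.1] F := by
      refine (MvPolynomial.continuous_eval F).comp (continuous_pi fun i => ?_)
      fin_cases i <;> simp <;> fun_prop
    refine hc.continuousAt.eventually (lt_mem_nhds ?_)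
    simpa [evalSin] using hF x hx
  obtain ⟨ε, hε, hball⟩ := Metric.eventually_nhds_iff.1 htube
  have hunif := Metric.tendstoUniformlyOn_iff.1 tendstoUniformlyOn_sinTaylor ε hε
  obtain ⟨N, hN⟩ := eventually_atTop.1 hunif
  refine ⟨N, fun x hx y hy1 hy2 => ?_⟩
  have h1 := hN (2 * N) (by omega) x hx
  have h2 := hN (2 * N + 1) (by omega) x hx
  rw [Real.dist_eq, abs_lt] at h1 h2
  have := hball (y := y - Real.sin x)
    (by rw [Real.dist_eq, sub_zero, abs_lt]; constructor <;> linarith) x hx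
  simpa using this

theorem exists_evalSin_eq (f : SinDomain → ℝ) (hf : f ∈ polySinAlgebra) :
    ∃ F : MvPolynomial (Fin 2) ℝ, ∀ x : SinDomain, f x = evalSin F x := by
  induction hf using Algebra.adjoin_induction with
  | mem f hf =>
    rcases hf with rfl | rfl
    · exact ⟨.X 0, fun x => by simp [evalSin]⟩
    · exact ⟨.X 1, fun x => by simp [evalSin]⟩
  | algebraMap r => exact ⟨.C r, fun x => by simp [evalSin]⟩
  | add f g _ _ hf hg =>
    obtain ⟨F, hF⟩ := hf
    obtain ⟨G, hG⟩ := hg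
    exact ⟨F + G, fun x => by simp [evalSin, hF, hG]⟩
  | mul f g _ _ hf hg =>
    obtain ⟨F, hF⟩ := hf
    obtain ⟨G, hG⟩ := hg
    exact ⟨F * G, fun x => by simp [evalSin, hF, hG]⟩

theorem mainTheorem12 (f : SinDomain → ℝ) (hf : f ∈ polySinAlgebra)
    (hpos : ∀ x : SinDomain, 0 < f x) :
    ∃ (k : ℕ) (σ σ₀ σ₂ σ₃ σ₄ : MvPolynomial (Fin 2) ℝ),
      IsSumSq σ ∧ IsSumSq σ₀ ∧ IsSumSq σ₂ ∧ IsSumSq σ₃ ∧ IsSumSq σ₄ ∧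
      ∀ x : SinDomain,
        f x = evalSin σ x + (x : ℝ) * evalSin σ₀ x + (Real.pi / 2 - (x : ℝ)) * evalSin σ₂ x
          + ((sinTaylor (2 * k)).eval (x : ℝ) - Real.sin (x : ℝ)) * evalSin σ₃ x
          + (Real.sin (x : ℝ) - (sinTaylor (2 * k + 1)).eval (x : ℝ)) * evalSin σ₄ x := by
  obtain ⟨F, hF⟩ := exists_evalSin_eq f hf
  obtain ⟨k, hk⟩ := exists_forall_strip_eval_pos F fun x hx => by
    rw [← hF ⟨x, hx⟩]
    exact hpos _
  set g := stripGenerators (Real.pi / 2) (sinTaylor (2 * k)) (sinTaylor (2 * k + 1)) with hg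
  have haeval : ∀ (χ : MvPolynomial (Fin 2) ℝ →ₐ[ℝ] ℝ) (p : Polynomial ℝ),
      χ (Polynomial.aeval (.X 0) p) = p.eval (χ (.X 0)) := fun χ p => by
    rw [← Polynomial.aeval_algHom_apply, Polynomial.coe_aeval_eq_eval]
  have hmem : F ∈ quadraticModule g := by
    refine (isArchimedeanQuadraticModule_strip _ _ _).mem_of_forall_algHom_pos fun χ hχ => ?_
    have g0 := hχ _ (mem_quadraticModule g 0)
    have g1 := hχ _ (mem_quadraticModule g 1)
    have g2 := hχ _ (mem_quadraticModule g 2)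
    have g3 := hχ _ (mem_quadraticModule g 3)
    simp only [hg, stripGenerators, Matrix.cons_val, map_sub, haeval] at g0 g1 g2 g3
    have hC : χ (.C (Real.pi / 2)) = Real.pi / 2 := χ.commutes _
    rw [hC] at g1
    have h := hk (χ (.X 0)) ⟨g0, sub_nonneg.1 g1⟩ (χ (.X 1)) (sub_nonneg.1 g2) (sub_nonneg.1 g3)
    -- A character of the polynomial ring is evaluation at the images of the variables, here a point
    -- of the strip.
    have hχe : χ = MvPolynomial.aeval ![χ (.X 0), χ (.X 1)] := by
      refine MvPolynomial.algHom_ext fun i => ?_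
      fin_cases i <;> simp
    rw [hχe]
    simpa [MvPolynomial.aeval_eq_eval] using h
  obtain ⟨σ, τ, hσ, hτ, rfl⟩ := hmem
  refine ⟨k, σ, τ 0, τ 1, τ 2, τ 3, hσ, hτ 0, hτ 1, hτ 2, hτ 3, fun x => ?_⟩
  have heval : ∀ p : Polynomial ℝ,
      MvPolynomial.eval ![(x : ℝ), Real.sin x] (Polynomial.aeval (.X 0) p) = p.eval (x : ℝ) :=
    fun p => by
      have := haeval (MvPolynomial.aeval ![(x : ℝ), Real.sin x]) p
      simpa [MvPolynomial.aeval_eq_eval] using this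
  rw [hF x]
  simp [evalSin, Fin.sum_univ_four, hg, stripGenerators, heval]
  ring
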